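/- Let $M$ be a smooth ($C^\infty$), Hausdorff, second countable, finite-dimensional manifold, and let $TM\setminus\{0\}$ be its tangent bundle with the zero section removed, with projection $\pi : TM\setminus\{0\}\to M$. Let $\mathbb{C}$ be the Liouville vector field on $TM\setminus\{0\}$, $\mathbb{C}(u) = \frac{d}{dt}\big|_{t=0}(u+tu)$, and let $J$ be the tangent structure, the $(1,1)$-tensor field $J(\xi)=\frac{d}{dt}\big|_{t=0}(u+t\,D\pi(\xi))$ for $\xi\in T_u(TM\setminus\{0\})$. Let $S$ be a spray on $M$, that is, a smooth vector field on $TM\setminus\{0\}$ with $JS=\mathbb{C}$ and $[\mathbb{C},S]=S$. Put $$h=\tfrac12(\mathrm{Id}-\mathcal{L}_SJ),\qquad v=\tfrac12(\mathrm{Id}+\mathcal{L}_SJ),\qquad (\mathcal{L}_SJ)(X)=[S,JX]-J[S,X],$$ and let $\nabla$ be the dynamical covariant derivative induced by $S$: on functions $\nabla f=S(f)$, on smooth vector fields $X$ on $TM\setminus\{0\}$ $$\nabla X=h[S,hX]+v[S,vX],$$ and on smooth $k$-forms $\omega$ on $TM\setminus\{0\}$, $k\ge 0$, by the Leibniz rule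 $$(\nabla\omega)(X_1,\dots,X_k)=S\big(\omega(X_1,\dots,X_k)\big)-\sum_{i=1}^k\omega(X_1,\dots,\nabla X_i,\dots,X_k).$$ For a vector field $X$ let $i_X$ be the inner product on forms, $(i_X\omega)(X_1,\dots,X_{k-1})=\omega(X,X_1,\dots,X_{k-1})$ for $k\ge1$, and $i_Xf=0$ for functions $f$. Then: (i) $\nabla S=0$ and $\nabla\mathbb{C}=0$; (ii) $\nabla i_S\omega=i_S\nabla\omega$ and $\nabla i_{\mathbb{C}}\,\omega=i_{\mathbb{C}}\nabla\omega$ for every $k\ge0$ and every smooth $k$-form $\omega$ on $TM\setminus\{0\}$. -/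

import Mathlib

open scoped Manifold ContDiff Topology Bundle

noncomputable section

namespace TangentCalculus

section Generic

variable {F : Type*} [NormedAddCommGroup F] [NormedSpace ℝ F] {H : Type*} [TopologicalSpace H]
  (I : ModelWithCorners ℝ F H) (N : Type*) [TopologicalSpace N] [ChartedSpace H N]

/-- The ring of smooth real functions on `N`. -/
abbrev SmoothFn := C^∞⟮I, N; 𝓘(ℝ, ℝ), ℝ⟯

variable [IsManifold I ∞ N]

/-- The smooth vector fields on `N`. -/
abbrev VField := Cₛ^∞⟮I; F, (TangentSpace I : N → Type _)⟯

variable {I N}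

/-- Pointwise multiplication of a vector field by a function. -/
instance instSMulVField : SMul (SmoothFn I N) (VField I N) :=
  ⟨fun f X ↦ ⟨fun p ↦ f p • X p, f.contMDiff.smul_section X.contMDiff⟩⟩

@[simp]
theorem VField.smul_apply (f : SmoothFn I N) (X : VField I N) (p : N) :
    (f • X) p = f p • X p := rfl

/-- The vector fields form a module over the ring of smooth functions. -/
instance instModuleVField : Module (SmoothFn I N) (VField I N) where
  one_smul X := by ext p; exact one_smul ℝ (X p)
  mul_smul f g X := by ext p; exact mul_smul (f p) (g p) (X p)
  smul_zero f := by ext p; exact smul_zero (f p)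
  smul_add f X Y := by ext p; exact smul_add (f p) (X p) (Y p)
  add_smul f g X := by ext p; exact add_smul (f p) (g p) (X p)
  zero_smul X := by ext p; exact zero_smul ℝ (X p)

instance instSMulCommClassVField : SMulCommClass (SmoothFn I N) ℝ (VField I N) :=
  ⟨fun f c X ↦ by ext p; exact smul_comm (f p) c (X p)⟩

/-- The derivative `X f` of a function along a vector field. -/
def lieFn (X : VField I N) (f : SmoothFn I N) : SmoothFn I N where
  val p := mvfderiv I f p (X p)
  property := by
    have h1 : ContMDiff I 𝓘(ℝ, ℝ).tangent ∞
        (fun p ↦ tangentMap I 𝓘(ℝ, ℝ) f (⟨p, X p⟩ : TangentBundle I N)) :=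
      (f.contMDiff.contMDiff_tangentMap (m := ∞) (by simp)).comp X.contMDiff
    intro p
    have h2 := (Bundle.contMDiffAt_totalSpace.1 (h1 p)).2
    simpa using! h2

theorem lieFn_apply (X : VField I N) (f : SmoothFn I N) (p : N) :
    lieFn X f p = mvfderiv I f p (X p) := rfl

theorem lieFn_add (X : VField I N) (f g : SmoothFn I N) :
    lieFn X (f + g) = lieFn X f + lieFn X g := by
  ext p
  have := mvfderiv_add (f.mdifferentiableAt (x := p)) (g.mdifferentiableAt (x := p))
  exact congrArg (fun L ↦ L (X p)) this

theorem lieFn_mul (X : VField I N) (f g : SmoothFn I N) :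
    lieFn X (f * g) = lieFn X f * g + f * lieFn X g := by
  ext p
  have := mvfderiv_mul (f.mdifferentiableAt (x := p)) (g.mdifferentiableAt (x := p))
  have := congrArg (fun L ↦ L (X p)) this
  refine this.trans ?_
  simp [lieFn_apply]
  ring

theorem lieFn_zero (X : VField I N) : lieFn X (0 : SmoothFn I N) = 0 := by
  simpa using lieFn_add X 0 0

variable [CompleteSpace F]

/-- The Lie bracket of smooth vector fields. -/
def bracket (X Y : VField I N) : VField I N where
  toFun := VectorField.mlieBracket I X Y
  contMDiff_toFun := by
    have : IsManifold I (((⊤ : ℕ∞) : WithTop ℕ∞) + 1) N := ‹IsManifold I ∞ N›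
    have : IsManifold I (minSmoothness ℝ 2) N := by simpa using! (inferInstance : IsManifold I 2 N)
    have : IsManifold I (minSmoothness ℝ 3) N := by simpa using! (inferInstance : IsManifold I 3 N)
    exact ContDiff.mlieBracket_vectorField (m := ⊤) (n := ⊤) X.contMDiff Y.contMDiff (by simp)

theorem bracket_apply (X Y : VField I N) (p : N) :
    bracket X Y p = VectorField.mlieBracket I X Y p := rfl

theorem bracket_add (X Y Z : VField I N) :
    bracket X (Y + Z) = bracket X Y + bracket X Z := by
  ext p
  exact VectorField.mlieBracket_add_right Y.mdifferentiableAt Z.mdifferentiableAt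

theorem bracket_smul (X : VField I N) (f : SmoothFn I N) (Y : VField I N) :
    bracket X (f • Y) = lieFn X f • Y + f • bracket X Y := by
  have : IsManifold I (minSmoothness ℝ 2) N := by simpa using! (inferInstance : IsManifold I 2 N)
  ext p
  exact VectorField.mlieBracket_smul_right f.mdifferentiableAt Y.mdifferentiableAt

/-- `(1,1)`-tensor fields, as `C^∞(N)`-linear endomorphisms of the module of vector fields. -/
abbrev Tensor11 (I : ModelWithCorners ℝ F H) (N : Type*) [TopologicalSpace N] [ChartedSpace H N]
    [IsManifold I ∞ N] := VField I N →ₗ[SmoothFn I N] VField I N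

/-- The Lie derivative `L_X A = L_X ∘ A - A ∘ L_X` of a `(1,1)`-tensor field. -/
def lieTensor (X : VField I N) (A : Tensor11 I N) : Tensor11 I N where
  toFun Y := bracket X (A Y) - A (bracket X Y)
  map_add' Y Z := by
    simp only [map_add, bracket_add]
    abel
  map_smul' f Y := by
    simp only [map_smul, bracket_smul, map_add, RingHom.id_apply, smul_sub]
    abel

/-- Differential `k`-forms, as alternating `C^∞(N)`-multilinear maps on vector fields. -/
abbrev Form (I : ModelWithCorners ℝ F H) (N : Type*) [TopologicalSpace N] [ChartedSpace H N]
    [IsManifold I ∞ N] (k : ℕ) := VField I N [⋀^Fin k]→ₗ[SmoothFn I N] SmoothFn I N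

/-- The inner product `i_X : Λ^k → Λ^{k-1}`, `(i_X α)(X₁, …) = α(X, X₁, …)`; it is zero on
functions (`k = 0`). -/
def innerProd (X : VField I N) : (k : ℕ) → Form I N k → Form I N (k - 1)
  | 0, _ => 0
  | _ + 1, α => α.curryLeft X

/-- A derivation `(S, D)` of functions and vector fields, extended to `k`-forms by the Leibniz
rule `(D α)(X₁, …, X_k) = S (α(X₁, …, X_k)) - ∑ i, α(X₁, …, D X_i, …, X_k)`. -/
def derivForm (S : VField I N) (D : VField I N → VField I N)
    (hadd : ∀ X Y, D (X + Y) = D X + D Y)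
    (hsmul : ∀ (f : SmoothFn I N) X, D (f • X) = lieFn S f • X + f • D X)
    {k : ℕ} (α : Form I N k) : Form I N k where
  toFun X := lieFn S (α X) - ∑ i, α (Function.update X i (D (X i)))
  map_update_add' := by
    intro _ X i Y Z
    obtain rfl : ‹DecidableEq (Fin k)› = instDecidableEqFin k := Subsingleton.elim _ _
    have key : ∀ j, α (Function.update (Function.update X i (Y + Z)) j
          (D (Function.update X i (Y + Z) j))) =
        α (Function.update (Function.update X i Y) j (D (Function.update X i Y j))) +
        α (Function.update (Function.update X i Z) j (D (Function.update X i Z j))) := by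
      intro j
      rcases eq_or_ne j i with rfl | hj
      · simp [hadd, α.map_update_add]
      · simp only [Function.update_of_ne hj, Function.update_comm hj.symm]
        simp [α.map_update_add]
    simp only [key, Finset.sum_add_distrib, α.map_update_add, lieFn_add]
    abel
  map_update_smul' := by
    intro _ X i f Y
    obtain rfl : ‹DecidableEq (Fin k)› = instDecidableEqFin k := Subsingleton.elim _ _
    have key : ∀ j, α (Function.update (Function.update X i (f • Y)) j
          (D (Function.update X i (f • Y) j))) =
        f • α (Function.update (Function.update X i Y) j (D (Function.update X i Y j))) +
        if j = i then lieFn S f • α (Function.update X i Y) else 0 := by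
      intro j
      rcases eq_or_ne j i with rfl | hj
      · simp [hsmul, α.map_update_add, α.map_update_smul, add_comm]
      · simp only [Function.update_of_ne hj, Function.update_comm hj.symm]
        simp [α.map_update_smul, hj]
    simp only [key, Finset.sum_add_distrib, α.map_update_smul, smul_eq_mul, lieFn_mul,
      Finset.sum_ite_eq', Finset.mem_univ, if_true, ← Finset.mul_sum]
    ring
  map_eq_zero_of_eq' := by
    intro X i j hij hne
    have h0 : α X = 0 := α.map_eq_zero_of_eq X hij hne
    have hsum : ∑ l, α (Function.update X l (D (X l))) =
        α (Function.update X i (D (X i))) + α (Function.update X j (D (X j))) := by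
      refine Finset.sum_eq_add i j hne (fun l _ hl ↦ ?_) (by simp) (by simp)
      exact α.map_eq_zero_of_eq _ (by simp [Function.update_of_ne hl.1.symm,
        Function.update_of_ne hl.2.symm, hij]) hne
    have hswap : Function.update X j (D (X j)) =
        Function.update X i (D (X i)) ∘ Equiv.swap i j := by
      funext l
      rcases eq_or_ne l i with rfl | hli
      · simp [Function.update_of_ne hne, Function.update_of_ne hne.symm, hij]
      rcases eq_or_ne l j with rfl | hlj
      · simp [hij]
      · simp [Equiv.swap_apply_of_ne_of_ne hli hlj, hli, hlj]
    rw [h0, lieFn_zero, hsum, hswap, α.map_swap _ hne]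
    simp

end Generic

section Slit

variable {E : Type*} [NormedAddCommGroup E] [NormedSpace ℝ E]
  {M : Type*} [TopologicalSpace M] [ChartedSpace E M] [IsManifold 𝓘(ℝ, E) ∞ M]

theorem trivializationAt_snd {p₀ : M} (u : TangentBundle 𝓘(ℝ, E) M)
    (hu : u.proj ∈ (chartAt E p₀).source) :
    (trivializationAt E (TangentSpace 𝓘(ℝ, E)) p₀ u).2 =
      (trivializationAt E (TangentSpace 𝓘(ℝ, E)) p₀).continuousLinearMapAt ℝ u.proj u.2 := by
  rw [Bundle.Trivialization.continuousLinearMapAt_apply, Bundle.Trivialization.linearMapAt_apply,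
    if_pos (by simpa using hu)]

variable (E M) in
/-- The slit tangent bundle `TM ∖ {0}`, an open subset of `TM`. -/
def slit : TopologicalSpace.Opens (TangentBundle 𝓘(ℝ, E) M) where
  carrier := {u | u.2 ≠ 0}
  is_open' := by
    rw [isOpen_iff_mem_nhds]
    intro u hu
    set e := trivializationAt E (TangentSpace 𝓘(ℝ, E) : M → Type _) u.proj with he
    have hmem : ∀ v : TangentBundle 𝓘(ℝ, E) M, v.proj ∈ (chartAt E u.proj).source →
        ((e v).2 ≠ 0 ↔ v.2 ≠ 0) := by
      intro v hv
      have hv' : v.proj ∈ e.baseSet := by simpa [he] using hv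
      rw [trivializationAt_snd v hv]
      change e.continuousLinearMapAt ℝ v.proj v.2 ≠ 0 ↔ _
      rw [← e.coe_continuousLinearEquivAt_eq hv']
      exact (e.continuousLinearEquivAt ℝ v.proj hv').map_ne_zero_iff
    have hsrc : u ∈ e.source := by simp [he]
    have hc : ContinuousAt (fun v ↦ (e v).2) u := (e.continuousAt hsrc).snd
    have h1 : ∀ᶠ v in 𝓝 u, (e v).2 ≠ 0 :=
      hc.eventually_ne ((hmem u (mem_chart_source E u.proj)).2 hu)
    have h2 : ∀ᶠ v in 𝓝 u, v ∈ e.source := e.open_source.mem_nhds hsrc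
    filter_upwards [h1, h2] with v hv1 hv2
    exact (hmem v (by simpa [he] using hv2)).1 hv1

theorem mem_slit {u : TangentBundle 𝓘(ℝ, E) M} : u ∈ slit E M ↔ u.2 ≠ 0 := Iff.rfl

/-- The canonical submersion `TM ∖ {0} → M`. -/
abbrev slitProj (u : slit E M) : M := u.1.proj

open Classical in
/-- The point `u + t w` of the fibre through `u` (set to `u` if it is the zero vector,
which does not happen for `t` near `0`). -/
def fibreLine (u : slit E M) (w : TangentSpace 𝓘(ℝ, E) (slitProj u)) (t : ℝ) : slit E M :=
  if h : (⟨slitProj u, u.1.2 + t • w⟩ : TangentBundle 𝓘(ℝ, E) M) ∈ slit E M then ⟨_, h⟩ else u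

/-- The vertical lift of `w` at `u`: the velocity `(u + t w)'(0)`. -/
def vertLift (u : slit E M) (w : TangentSpace 𝓘(ℝ, E) (slitProj u)) :
    TangentSpace 𝓘(ℝ, E).tangent u :=
  mfderiv 𝓘(ℝ, ℝ) 𝓘(ℝ, E).tangent (fibreLine u w) 0 (1 : ℝ)

theorem contMDiff_slitProj :
    ContMDiff 𝓘(ℝ, E).tangent 𝓘(ℝ, E) ∞ (slitProj : slit E M → M) :=
  (Bundle.contMDiff_proj (TangentSpace 𝓘(ℝ, E) : M → Type _)).comp contMDiff_subtype_val

theorem fibreLine_zero (u : slit E M) (w : TangentSpace 𝓘(ℝ, E) (slitProj u)) :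
    fibreLine u w 0 = u := by
  unfold fibreLine
  split_ifs with h
  · apply Subtype.ext
    simp [slitProj]
  · rfl

/-- The second component of the bundle trivialization at `p₀`, as a linear map on `T_p M`. -/
def fibreCoord (p₀ p : M) : TangentSpace 𝓘(ℝ, E) p →L[ℝ] E :=
  (trivializationAt E (TangentSpace 𝓘(ℝ, E)) p₀).continuousLinearMapAt ℝ p

theorem fibreLine_eventually (u : slit E M) (w : TangentSpace 𝓘(ℝ, E) (slitProj u)) :
    ∀ᶠ t in 𝓝 (0 : ℝ), (fibreLine u w t).1 = ⟨slitProj u, u.1.2 + t • w⟩ := by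
  have key : ∀ a b : E, a ≠ 0 → ∀ᶠ t in 𝓝 (0 : ℝ), a + t • b ≠ 0 := by
    intro a b ha
    have hc : ContinuousAt (fun t : ℝ ↦ a + t • b) 0 := Continuous.continuousAt (by fun_prop)
    exact hc.eventually_ne (by simpa using ha)
  have : ∀ᶠ t in 𝓝 (0 : ℝ), u.1.2 + t • w ≠ 0 := key _ _ u.2
  filter_upwards [this] with t ht
  unfold fibreLine
  rw [dif_pos (mem_slit.2 ht)]

theorem extChartAt_slit (u₀ u : slit E M)
    (hu : slitProj u ∈ (chartAt E (slitProj u₀)).source) :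
    extChartAt 𝓘(ℝ, E).tangent u₀ u =
      (extChartAt 𝓘(ℝ, E) (slitProj u₀) (slitProj u), fibreCoord (slitProj u₀) (slitProj u) u.1.2) := by
  have : extChartAt 𝓘(ℝ, E).tangent u₀ u = extChartAt 𝓘(ℝ, E).tangent u₀.1 u.1 := rfl
  rw [this, FiberBundle.extChartAt]
  refine Prod.ext rfl ?_
  exact trivializationAt_snd u.1 hu

theorem mem_chart_slit (u₀ u : slit E M) :
    u ∈ (chartAt (ModelProd E E) u₀).source ↔ slitProj u ∈ (chartAt E (slitProj u₀)).source := by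
  have : u ∈ (chartAt (ModelProd E E) u₀).source ↔
    u.1 ∈ (chartAt (ModelProd E E) u₀.1).source := by
      rw [TopologicalSpace.Opens.chartAt_eq]
      simp [OpenPartialHomeomorph.subtypeRestr]
  rw [this, TangentBundle.mem_chart_source_iff]

theorem contMDiffAt_fibreLine (u : slit E M) (w : TangentSpace 𝓘(ℝ, E) (slitProj u)) :
    ContMDiffAt 𝓘(ℝ, ℝ) 𝓘(ℝ, E).tangent ∞ (fibreLine u w) 0 := by
  rw [← ContMDiffAt.subtypeVal_comp_iff]
  have h : ContMDiffAt 𝓘(ℝ, ℝ) 𝓘(ℝ, E).tangent ∞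
      (fun t : ℝ ↦ (⟨slitProj u, u.1.2 + t • w⟩ : TangentBundle 𝓘(ℝ, E) M)) 0 := by
    refine Bundle.contMDiffAt_totalSpace.2 ⟨contMDiffAt_const, ?_⟩
    have : (fun t : ℝ ↦ (trivializationAt E (TangentSpace 𝓘(ℝ, E)) (slitProj u)
        (⟨slitProj u, u.1.2 + t • w⟩ : TangentBundle 𝓘(ℝ, E) M)).2) =
        fun t ↦ fibreCoord (slitProj u) (slitProj u) u.1.2 +
          t • fibreCoord (slitProj u) (slitProj u) w := by
      funext t
      rw [trivializationAt_snd (⟨slitProj u, u.1.2 + t • w⟩ : TangentBundle 𝓘(ℝ, E) M)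
        (mem_chart_source E (slitProj u))]
      change fibreCoord (slitProj u) (slitProj u) (u.1.2 + t • w) = _
      simp
    refine ContDiffAt.contMDiffAt ?_
    change ContDiffAt ℝ ∞ (fun t : ℝ ↦ (trivializationAt E (TangentSpace 𝓘(ℝ, E)) (slitProj u)
        (⟨slitProj u, u.1.2 + t • w⟩ : TangentBundle 𝓘(ℝ, E) M)).2) 0
    rw [this]
    exact ContDiff.contDiffAt (by fun_prop)
  exact h.congr_of_eventuallyEq (fibreLine_eventually u w)

/-- In bundle coordinates the vertical lift of `w` is `(0, w)`. -/
theorem mfderiv_chart_vertLift (u₀ u : slit E M)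
    (hu : slitProj u ∈ (chartAt E (slitProj u₀)).source)
    (w : TangentSpace 𝓘(ℝ, E) (slitProj u)) :
    mfderiv 𝓘(ℝ, E).tangent 𝓘(ℝ, E × E) (extChartAt 𝓘(ℝ, E).tangent u₀) u (vertLift u w) =
      ((0 : E), fibreCoord (slitProj u₀) (slitProj u) w) := by
  have hc : MDifferentiableAt 𝓘(ℝ, ℝ) 𝓘(ℝ, E).tangent (fibreLine u w) 0 :=
    (contMDiffAt_fibreLine u w).mdifferentiableAt (by simp)
  have hφ : MDifferentiableAt 𝓘(ℝ, E).tangent 𝓘(ℝ, E × E) (extChartAt 𝓘(ℝ, E).tangent u₀) u :=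
    mdifferentiableAt_extChartAt ((mem_chart_slit u₀ u).2 hu)
  have hD := hφ.hasMFDerivAt
  unfold vertLift
  generalize (mfderiv 𝓘(ℝ, E).tangent 𝓘(ℝ, E × E) (extChartAt 𝓘(ℝ, E).tangent u₀) u) = D at hD ⊢
  have hD' : HasMFDerivAt 𝓘(ℝ, E).tangent 𝓘(ℝ, E × E) (extChartAt 𝓘(ℝ, E).tangent u₀)
      (fibreLine u w 0) (D : E × E →L[ℝ] E × E) := by
    rw [fibreLine_zero]
    exact hD
  have hF : HasFDerivAt (extChartAt 𝓘(ℝ, E).tangent u₀ ∘ fibreLine u w : ℝ → E × E)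
      ((D : E × E →L[ℝ] E × E).comp (mfderiv 𝓘(ℝ, ℝ) 𝓘(ℝ, E).tangent (fibreLine u w) 0 :
        ℝ →L[ℝ] E × E)) 0 := (hD'.comp 0 hc.hasMFDerivAt).hasFDerivAt
  set a := extChartAt 𝓘(ℝ, E) (slitProj u₀) (slitProj u)
  set A : TangentSpace 𝓘(ℝ, E) (slitProj u) →L[ℝ] E := fibreCoord (slitProj u₀) (slitProj u)
  have heq : (extChartAt 𝓘(ℝ, E).tangent u₀ ∘ fibreLine u w) =ᶠ[𝓝 0]
      fun t ↦ ((a, A u.1.2 + t • A w) : E × E) := by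
    filter_upwards [fibreLine_eventually u w] with t ht
    have hp : slitProj (fibreLine u w t) = slitProj u := by
      simp only [slitProj, ht]
    have h1 := extChartAt_slit u₀ (fibreLine u w t) (by rw [hp]; exact hu)
    rw [Function.comp_apply, h1]
    refine Prod.ext ?_ ?_
    · simp only [slitProj, ht, a]
    · change (fun v : TangentBundle 𝓘(ℝ, E) M ↦ fibreCoord (slitProj u₀) v.proj v.2)
        (fibreLine u w t).1 = A u.1.2 + t • A w
      rw [ht]
      change A (u.1.2 + t • w) = _
      simp
  have h2 : HasDerivAt (fun t : ℝ ↦ ((a, A u.1.2 + t • A w) : E × E)) (0, A w) 0 := by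
    refine (hasDerivAt_const _ _).prodMk ?_
    simpa using ((hasDerivAt_id (0 : ℝ)).smul_const (A w)).const_add (A u.1.2)
  have hG : HasFDerivAt (extChartAt 𝓘(ℝ, E).tangent u₀ ∘ fibreLine u w : ℝ → E × E)
      (ContinuousLinearMap.toSpanSingleton ℝ ((0 : E), (A w : E))) 0 :=
    (h2.congr_of_eventuallyEq heq).hasFDerivAt
  have h3 := HasFDerivAt.unique (𝕜 := ℝ) (E := ℝ) (F := E × E) hF hG
  have h4 := congrArg (fun L : ℝ →L[ℝ] E × E ↦ L 1) h3
  exact h4.trans (one_smul ℝ ((0 : E), (A w : E)))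

/-- In bundle coordinates `Dπ` is the first projection. -/
theorem mfderiv_chart_fst (u₀ u : slit E M)
    (hu : slitProj u ∈ (chartAt E (slitProj u₀)).source)
    (ξ : TangentSpace 𝓘(ℝ, E).tangent u) :
    fibreCoord (slitProj u₀) (slitProj u) (mfderiv 𝓘(ℝ, E).tangent 𝓘(ℝ, E) slitProj u ξ) =
    (mfderiv 𝓘(ℝ, E).tangent 𝓘(ℝ, E × E) (extChartAt 𝓘(ℝ, E).tangent u₀) u ξ : E × E).1 := by
  have hφ : MDifferentiableAt 𝓘(ℝ, E).tangent 𝓘(ℝ, E × E) (extChartAt 𝓘(ℝ, E).tangent u₀) u :=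
    mdifferentiableAt_extChartAt ((mem_chart_slit u₀ u).2 hu)
  have hπ : MDifferentiableAt 𝓘(ℝ, E).tangent 𝓘(ℝ, E) (slitProj : slit E M → M) u :=
    contMDiff_slitProj.mdifferentiable (by simp) u
  have hψ : MDifferentiableAt 𝓘(ℝ, E) 𝓘(ℝ, E) (extChartAt 𝓘(ℝ, E) (slitProj u₀)) (slitProj u) :=
    mdifferentiableAt_extChartAt hu
  have hfst : HasMFDerivAt 𝓘(ℝ, E × E) 𝓘(ℝ, E) (Prod.fst : E × E → E)
      (extChartAt 𝓘(ℝ, E).tangent u₀ u) (ContinuousLinearMap.fst ℝ E E) :=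
    hasFDerivAt_fst.hasMFDerivAt
  have h1 := hfst.comp u hφ.hasMFDerivAt
  have h2 := hψ.hasMFDerivAt.comp u hπ.hasMFDerivAt
  have heq : (Prod.fst : E × E → E) ∘ extChartAt 𝓘(ℝ, E).tangent u₀ =
      extChartAt 𝓘(ℝ, E) (slitProj u₀) ∘ slitProj := rfl
  rw [heq] at h1
  have h3 := hasMFDerivAt_unique h2 h1
  have h4 := TangentBundle.continuousLinearMapAt_trivializationAt (I := 𝓘(ℝ, E)) hu
  change (trivializationAt E (TangentSpace 𝓘(ℝ, E)) (slitProj u₀)).continuousLinearMapAt ℝ _ _ = _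
  rw [h4]
  exact congrArg (fun L ↦ L ξ) h3

theorem coord_eq (u₀ u : slit E M) (hu : u ∈ (chartAt (ModelProd E E) u₀).source)
    (ξ : TangentSpace 𝓘(ℝ, E).tangent u) :
    (trivializationAt (E × E) (TangentSpace 𝓘(ℝ, E).tangent) u₀ ⟨u, ξ⟩).2 =
      mfderiv 𝓘(ℝ, E).tangent 𝓘(ℝ, E × E) (extChartAt 𝓘(ℝ, E).tangent u₀) u ξ := by
  have h : (trivializationAt (E × E) (TangentSpace 𝓘(ℝ, E).tangent) u₀ ⟨u, ξ⟩).2 =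
      (trivializationAt (E × E) (TangentSpace 𝓘(ℝ, E).tangent) u₀).continuousLinearMapAt ℝ u ξ := by
    rw [Bundle.Trivialization.continuousLinearMapAt_apply,
      Bundle.Trivialization.linearMapAt_apply, if_pos (by simpa using hu)]
  exact h.trans (congrArg (fun L ↦ L ξ)
    (TangentBundle.continuousLinearMapAt_trivializationAt (I := 𝓘(ℝ, E).tangent) hu))

theorem coord_add (u₀ u : slit E M) (hu : u ∈ (chartAt (ModelProd E E) u₀).source)
    (ξ η : TangentSpace 𝓘(ℝ, E).tangent u) :
    (trivializationAt (E × E) (TangentSpace 𝓘(ℝ, E).tangent) u₀ ⟨u, ξ + η⟩).2 =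
      (trivializationAt (E × E) (TangentSpace 𝓘(ℝ, E).tangent) u₀ ⟨u, ξ⟩).2 +
      (trivializationAt (E × E) (TangentSpace 𝓘(ℝ, E).tangent) u₀ ⟨u, η⟩).2 := by
  rw [coord_eq u₀ u hu, coord_eq u₀ u hu, coord_eq u₀ u hu]
  exact map_add _ ξ η

theorem coord_smul (u₀ u : slit E M) (hu : u ∈ (chartAt (ModelProd E E) u₀).source)
    (c : ℝ) (ξ : TangentSpace 𝓘(ℝ, E).tangent u) :
    (trivializationAt (E × E) (TangentSpace 𝓘(ℝ, E).tangent) u₀ ⟨u, c • ξ⟩).2 =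
      c • (trivializationAt (E × E) (TangentSpace 𝓘(ℝ, E).tangent) u₀ ⟨u, ξ⟩).2 := by
  rw [coord_eq u₀ u hu, coord_eq u₀ u hu]
  exact map_smul _ c ξ

/-- The Liouville (dilatation) vector field `C(u) = (u + t u)'(0)`. -/
def liouville : VField 𝓘(ℝ, E).tangent (slit E M) where
  toFun u := vertLift u u.1.2
  contMDiff_toFun := by
    intro u₀
    rw [Bundle.contMDiffAt_section]
    have hs : ∀ᶠ u in 𝓝 u₀, u ∈ (chartAt (ModelProd E E) u₀).source :=
      (chartAt (ModelProd E E) u₀).open_source.mem_nhds (mem_chart_source _ u₀)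
    have hchart : ContMDiffAt 𝓘(ℝ, E).tangent 𝓘(ℝ, E × E) ∞
        (extChartAt 𝓘(ℝ, E).tangent u₀) u₀ := contMDiffAt_extChartAt
    have hlin : ContMDiff 𝓘(ℝ, E × E) 𝓘(ℝ, E × E) ∞ (fun z : E × E ↦ ((0 : E), z.2)) :=
      ContDiff.contMDiff (by fun_prop)
    refine (hlin.contMDiffAt.comp u₀ hchart).congr_of_eventuallyEq ?_
    filter_upwards [hs] with u hu
    have hu' := (mem_chart_slit u₀ u).1 hu
    rw [coord_eq u₀ u hu, mfderiv_chart_vertLift u₀ u hu', Function.comp_apply,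
      extChartAt_slit u₀ u hu']

/-- The tangent structure (vertical endomorphism) at `u`: `J ξ = (u + t Dπ(ξ))'(0)`. -/
def tangentStructureAt (u : slit E M) (ξ : TangentSpace 𝓘(ℝ, E).tangent u) :
    TangentSpace 𝓘(ℝ, E).tangent u :=
  vertLift u (mfderiv 𝓘(ℝ, E).tangent 𝓘(ℝ, E) slitProj u ξ)

theorem coord_tangentStructureAt (u₀ u : slit E M)
    (hu : u ∈ (chartAt (ModelProd E E) u₀).source) (ξ : TangentSpace 𝓘(ℝ, E).tangent u) :
    (trivializationAt (E × E) (TangentSpace 𝓘(ℝ, E).tangent) u₀ ⟨u, tangentStructureAt u ξ⟩).2 =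
      ((0 : E), (trivializationAt (E × E) (TangentSpace 𝓘(ℝ, E).tangent) u₀ ⟨u, ξ⟩).2.1) := by
  have hu' := (mem_chart_slit u₀ u).1 hu
  rw [coord_eq u₀ u hu, coord_eq u₀ u hu, tangentStructureAt, mfderiv_chart_vertLift u₀ u hu',
    mfderiv_chart_fst u₀ u hu']

theorem coord_injective (u₀ u : slit E M) (hu : u ∈ (chartAt (ModelProd E E) u₀).source)
    {ξ η : TangentSpace 𝓘(ℝ, E).tangent u}
    (h : (trivializationAt (E × E) (TangentSpace 𝓘(ℝ, E).tangent) u₀ ⟨u, ξ⟩).2 =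
      (trivializationAt (E × E) (TangentSpace 𝓘(ℝ, E).tangent) u₀ ⟨u, η⟩).2) : ξ = η := by
  rw [coord_eq u₀ u hu, coord_eq u₀ u hu] at h
  exact (isInvertible_mfderiv_extChartAt (I := 𝓘(ℝ, E).tangent) (x := u₀) (y := u)
    (by rwa [extChartAt_source])).injective h

theorem tangentStructureAt_add (u : slit E M) (ξ η : TangentSpace 𝓘(ℝ, E).tangent u) :
    tangentStructureAt u (ξ + η) = tangentStructureAt u ξ + tangentStructureAt u η := by
  have hu := mem_chart_source (ModelProd E E) u
  refine coord_injective u u hu ?_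
  rw [coord_tangentStructureAt u u hu, coord_add u u hu, coord_add u u hu,
    coord_tangentStructureAt u u hu, coord_tangentStructureAt u u hu]
  simp

theorem tangentStructureAt_smul (u : slit E M) (c : ℝ) (ξ : TangentSpace 𝓘(ℝ, E).tangent u) :
    tangentStructureAt u (c • ξ) = c • tangentStructureAt u ξ := by
  have hu := mem_chart_source (ModelProd E E) u
  refine coord_injective u u hu ?_
  rw [coord_tangentStructureAt u u hu, coord_smul u u hu, coord_smul u u hu,
    coord_tangentStructureAt u u hu]
  simp

/-- The tangent structure `J`, a `(1,1)`-tensor field on `TM ∖ {0}`. -/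
def tangentStructure : Tensor11 𝓘(ℝ, E).tangent (slit E M) where
  toFun X :=
    { toFun := fun u ↦ tangentStructureAt u (X u)
      contMDiff_toFun := by
        intro u₀
        rw [Bundle.contMDiffAt_section]
        have hs : ∀ᶠ u in 𝓝 u₀, u ∈ (chartAt (ModelProd E E) u₀).source :=
          (chartAt (ModelProd E E) u₀).open_source.mem_nhds (mem_chart_source _ u₀)
        have hX := (Bundle.contMDiffAt_section u₀).1 (X.contMDiff u₀)
        have hlin : ContMDiff 𝓘(ℝ, E × E) 𝓘(ℝ, E × E) ∞ (fun z : E × E ↦ ((0 : E), z.1)) :=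
          ContDiff.contMDiff (by fun_prop)
        refine (hlin.contMDiffAt.comp u₀ hX).congr_of_eventuallyEq ?_
        filter_upwards [hs] with u hu
        exact coord_tangentStructureAt u₀ u hu (X u) }
  map_add' X Y := by
    ext u
    exact tangentStructureAt_add u (X u) (Y u)
  map_smul' f X := by
    ext u
    exact tangentStructureAt_smul u (f u) (X u)

/-- A vector field on `TM ∖ {0}` read in the bundle chart at `u₀`. -/
def chartRep (u₀ : slit E M) (X : VField 𝓘(ℝ, E).tangent (slit E M)) : E × E → E × E :=
  VectorField.mpullbackWithin 𝓘(ℝ, E × E) 𝓘(ℝ, E).tangent (extChartAt 𝓘(ℝ, E).tangent u₀).symm X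
    (Set.range 𝓘(ℝ, E).tangent)

theorem chartRep_eq (u₀ : slit E M) (X : VField 𝓘(ℝ, E).tangent (slit E M)) {u : slit E M}
    (hu : u ∈ (chartAt (ModelProd E E) u₀).source) :
    chartRep u₀ X (extChartAt 𝓘(ℝ, E).tangent u₀ u) =
      (trivializationAt (E × E) (TangentSpace 𝓘(ℝ, E).tangent) u₀ ⟨u, X u⟩).2 := by
  have hu' : u ∈ (extChartAt 𝓘(ℝ, E).tangent u₀).source := by rwa [extChartAt_source]
  have hinv : ∀ z ∈ (extChartAt 𝓘(ℝ, E).tangent u₀).target,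
      ContinuousLinearMap.inverse (mfderivWithin 𝓘(ℝ, E × E) 𝓘(ℝ, E).tangent
        (extChartAt 𝓘(ℝ, E).tangent u₀).symm (Set.range 𝓘(ℝ, E).tangent) z) =
      mfderiv 𝓘(ℝ, E).tangent 𝓘(ℝ, E × E) (extChartAt 𝓘(ℝ, E).tangent u₀)
        ((extChartAt 𝓘(ℝ, E).tangent u₀).symm z) := fun z hz ↦
    ContinuousLinearMap.inverse_eq (mfderivWithin_extChartAt_symm_comp_mfderiv_extChartAt hz)
      (mfderiv_extChartAt_comp_mfderivWithin_extChartAt_symm hz)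
  have hz := (extChartAt 𝓘(ℝ, E).tangent u₀).map_source hu'
  have hl := (extChartAt 𝓘(ℝ, E).tangent u₀).left_inv hu'
  have h1 : chartRep u₀ X (extChartAt 𝓘(ℝ, E).tangent u₀ u) =
      mfderiv 𝓘(ℝ, E).tangent 𝓘(ℝ, E × E) (extChartAt 𝓘(ℝ, E).tangent u₀)
        ((extChartAt 𝓘(ℝ, E).tangent u₀).symm (extChartAt 𝓘(ℝ, E).tangent u₀ u))
        (X ((extChartAt 𝓘(ℝ, E).tangent u₀).symm (extChartAt 𝓘(ℝ, E).tangent u₀ u))) :=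
    congrArg (fun L : E × E →L[ℝ] E × E ↦
      L (X ((extChartAt 𝓘(ℝ, E).tangent u₀).symm (extChartAt 𝓘(ℝ, E).tangent u₀ u)))) (hinv _ hz)
  rw [h1, hl, coord_eq u₀ u hu]

theorem chartRep_eventually (u₀ : slit E M) (X : VField 𝓘(ℝ, E).tangent (slit E M))
    (f : E × E → E)
    (h : ∀ u ∈ (chartAt (ModelProd E E) u₀).source,
      (trivializationAt (E × E) (TangentSpace 𝓘(ℝ, E).tangent) u₀ ⟨u, X u⟩).2.1 =
        f (extChartAt 𝓘(ℝ, E).tangent u₀ u)) :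
    ∀ᶠ z in 𝓝 (extChartAt 𝓘(ℝ, E).tangent u₀ u₀), (chartRep u₀ X z).1 = f z := by
  filter_upwards [extChartAt_target_mem_nhds (I := 𝓘(ℝ, E).tangent) u₀] with z hz
  have hs := (extChartAt 𝓘(ℝ, E).tangent u₀).map_target hz
  have hr := (extChartAt 𝓘(ℝ, E).tangent u₀).right_inv hz
  rw [extChartAt_source] at hs
  have h1 := chartRep_eq u₀ X hs
  have h2 := h _ hs
  rw [hr] at h1 h2
  rw [h1, h2]

theorem coord_liouville (u₀ u : slit E M) (hu : u ∈ (chartAt (ModelProd E E) u₀).source) :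
    (trivializationAt (E × E) (TangentSpace 𝓘(ℝ, E).tangent) u₀ ⟨u, liouville u⟩).2 =
      ((0 : E), (extChartAt 𝓘(ℝ, E).tangent u₀ u).2) := by
  have hu' := (mem_chart_slit u₀ u).1 hu
  rw [coord_eq u₀ u hu]
  refine (mfderiv_chart_vertLift u₀ u hu' u.1.2).trans ?_
  rw [extChartAt_slit u₀ u hu']

theorem coord_tangentStructure (u₀ u : slit E M)
    (hu : u ∈ (chartAt (ModelProd E E) u₀).source) (X : VField 𝓘(ℝ, E).tangent (slit E M)) :
    (trivializationAt (E × E) (TangentSpace 𝓘(ℝ, E).tangent) u₀ ⟨u, tangentStructure X u⟩).2 =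
      ((0 : E), (trivializationAt (E × E) (TangentSpace 𝓘(ℝ, E).tangent) u₀ ⟨u, X u⟩).2.1) :=
  coord_tangentStructureAt u₀ u hu (X u)

theorem tangentStructure_sq (X : VField 𝓘(ℝ, E).tangent (slit E M)) :
    tangentStructure (tangentStructure X) = 0 := by
  ext u
  have hu := mem_chart_source (ModelProd E E) u
  refine coord_injective u u hu ?_
  rw [coord_tangentStructure u u hu, coord_tangentStructure u u hu]
  have := coord_smul u u hu 0 (X u)
  rw [zero_smul, zero_smul] at this
  exact this.symm

variable [CompleteSpace E]

/-- A semispray on `M`: a vector field `S` on `TM ∖ {0}` with `J S = C`. -/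
def IsSemispray (S : VField 𝓘(ℝ, E).tangent (slit E M)) : Prop :=
  tangentStructure S = liouville

/-- A spray on `M`: a semispray which is `2`-homogeneous, `[C, S] = (2 - 1) S`. -/
def IsSpray (S : VField 𝓘(ℝ, E).tangent (slit E M)) : Prop :=
  IsSemispray S ∧ bracket liouville S = S

/-- The horizontal projector `h = (Id - L_S J) / 2`. -/
def horProj (S : VField 𝓘(ℝ, E).tangent (slit E M)) :
    Tensor11 𝓘(ℝ, E).tangent (slit E M) :=
  (1 / 2 : ℝ) • (LinearMap.id - lieTensor S tangentStructure)

/-- The vertical projector `v = (Id + L_S J) / 2`. -/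
def verProj (S : VField 𝓘(ℝ, E).tangent (slit E M)) :
    Tensor11 𝓘(ℝ, E).tangent (slit E M) :=
  (1 / 2 : ℝ) • (LinearMap.id + lieTensor S tangentStructure)

/-- The dynamical covariant derivative on vector fields, `∇ X = h[S, hX] + v[S, vX]`. -/
def nablaVField (S X : VField 𝓘(ℝ, E).tangent (slit E M)) :
    VField 𝓘(ℝ, E).tangent (slit E M) :=
  horProj S (bracket S (horProj S X)) + verProj S (bracket S (verProj S X))

theorem chartRep_differentiableAt (u₀ : slit E M) (X : VField 𝓘(ℝ, E).tangent (slit E M)) :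
    DifferentiableAt ℝ (chartRep u₀ X) (extChartAt 𝓘(ℝ, E).tangent u₀ u₀) := by
  have h : DifferentiableWithinAt ℝ (chartRep u₀ X)
      ((extChartAt 𝓘(ℝ, E).tangent u₀).symm ⁻¹' Set.univ ∩ Set.range 𝓘(ℝ, E).tangent)
      (extChartAt 𝓘(ℝ, E).tangent u₀ u₀) :=
    (X.mdifferentiableAt (x := u₀)).mdifferentiableWithinAt
      (s := Set.univ) |>.differentiableWithinAt_mpullbackWithin_vectorField
  rwa [Set.preimage_univ, Set.univ_inter, ModelWithCorners.range_eq_univ,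
    differentiableWithinAt_univ] at h

theorem coord_bracket (u₀ : slit E M) (X Y : VField 𝓘(ℝ, E).tangent (slit E M)) :
    (trivializationAt (E × E) (TangentSpace 𝓘(ℝ, E).tangent) u₀ ⟨u₀, bracket X Y u₀⟩).2 =
      VectorField.lieBracket ℝ (chartRep u₀ X) (chartRep u₀ Y)
        (extChartAt 𝓘(ℝ, E).tangent u₀ u₀) := by
  have hu := mem_chart_source (ModelProd E E) u₀
  have hinv : (mfderiv 𝓘(ℝ, E).tangent 𝓘(ℝ, E × E) (extChartAt 𝓘(ℝ, E).tangent u₀)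
      u₀).IsInvertible := isInvertible_mfderiv_extChartAt (mem_extChartAt_source u₀)
  have h1 : mfderiv 𝓘(ℝ, E).tangent 𝓘(ℝ, E × E) (extChartAt 𝓘(ℝ, E).tangent u₀) u₀
      (bracket X Y u₀) = VectorField.lieBracketWithin ℝ (chartRep u₀ X) (chartRep u₀ Y)
        ((extChartAt 𝓘(ℝ, E).tangent u₀).symm ⁻¹' Set.univ ∩ Set.range 𝓘(ℝ, E).tangent)
        (extChartAt 𝓘(ℝ, E).tangent u₀ u₀) := hinv.self_apply_inverse _
  rw [Set.preimage_univ, Set.univ_inter, ModelWithCorners.range_eq_univ,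
    VectorField.lieBracketWithin_univ] at h1
  exact (coord_eq u₀ u₀ hu _).trans h1

/-- For a semispray `S` and a vertical field `W`, `J [S, W] = -W`. -/
theorem tangentStructure_bracket {S W : VField 𝓘(ℝ, E).tangent (slit E M)} (hS : IsSemispray S)
    (hW : tangentStructure W = 0) : tangentStructure (bracket S W) = -W := by
  ext u₀
  have hu₀ := mem_chart_source (ModelProd E E) u₀
  have hS1 : ∀ u ∈ (chartAt (ModelProd E E) u₀).source,
      (trivializationAt (E × E) (TangentSpace 𝓘(ℝ, E).tangent) u₀ ⟨u, S u⟩).2.1 =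
        (extChartAt 𝓘(ℝ, E).tangent u₀ u).2 := by
    intro u hu
    have h1 := coord_tangentStructure u₀ u hu S
    rw [hS, coord_liouville u₀ u hu] at h1
    exact (congrArg Prod.snd h1).symm
  have hW1 : ∀ u ∈ (chartAt (ModelProd E E) u₀).source,
      (trivializationAt (E × E) (TangentSpace 𝓘(ℝ, E).tangent) u₀ ⟨u, W u⟩).2.1 = 0 := by
    intro u hu
    have h1 := coord_tangentStructure u₀ u hu W
    rw [hW] at h1
    have h2 := coord_smul u₀ u hu 0 (W u)
    rw [zero_smul, zero_smul] at h2
    exact (congrArg Prod.snd (h2.symm.trans h1)).symm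
  have eS := chartRep_eventually u₀ S Prod.snd hS1
  have eW := chartRep_eventually u₀ W (fun _ ↦ 0) hW1
  have dS := (chartRep_differentiableAt u₀ S).hasFDerivAt
  have dW := (chartRep_differentiableAt u₀ W).hasFDerivAt
  set z₀ := extChartAt 𝓘(ℝ, E).tangent u₀ u₀
  have hS2 : (ContinuousLinearMap.fst ℝ E E).comp (fderiv ℝ (chartRep u₀ S) z₀) =
      ContinuousLinearMap.snd ℝ E E :=
    (hasFDerivAt_fst.comp z₀ dS).unique (hasFDerivAt_snd.congr_of_eventuallyEq eS)
  have hW2 : (ContinuousLinearMap.fst ℝ E E).comp (fderiv ℝ (chartRep u₀ W) z₀) = 0 :=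
    (hasFDerivAt_fst.comp z₀ dW).unique ((hasFDerivAt_const (0 : E) z₀).congr_of_eventuallyEq eW)
  have hS3 := congrArg (fun L ↦ L (chartRep u₀ W z₀)) hS2
  have hW3 := congrArg (fun L ↦ L (chartRep u₀ S z₀)) hW2
  simp only [ContinuousLinearMap.comp_apply, ContinuousLinearMap.coe_fst',
    ContinuousLinearMap.coe_snd', _root_.zero_apply] at hS3 hW3
  refine coord_injective u₀ u₀ hu₀ ?_
  rw [coord_tangentStructure u₀ u₀ hu₀, coord_bracket, VectorField.lieBracket_eq]
  have hneg := coord_smul u₀ u₀ hu₀ (-1) (W u₀)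
  rw [neg_one_smul, neg_one_smul] at hneg
  refine Eq.trans ?_ hneg.symm
  have hWz := chartRep_eq u₀ W hu₀
  have hW0 := hW1 u₀ hu₀
  rw [← hWz] at hW0 ⊢
  refine Prod.ext ?_ ?_
  · simpa using! hW0
  · have e : ∀ a b c : E, a = 0 → b = c → a - b = -c := by
      rintro a b c rfl rfl
      exact zero_sub b
    exact e _ _ _ hW3 hS3

theorem lieTensor_vertical {S W : VField 𝓘(ℝ, E).tangent (slit E M)} (hS : IsSemispray S)
    (hW : tangentStructure W = 0) : lieTensor S tangentStructure W = W := by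
  have h0 : bracket S (0 : VField 𝓘(ℝ, E).tangent (slit E M)) = 0 := by
    simpa using bracket_add S 0 0
  change bracket S (tangentStructure W) - tangentStructure (bracket S W) = W
  rw [hW, h0, tangentStructure_bracket hS hW]
  simp

/-- `(L_S J)² = Id` for a semispray `S`. -/
theorem lieTensor_sq {S : VField 𝓘(ℝ, E).tangent (slit E M)} (hS : IsSemispray S)
    (X : VField 𝓘(ℝ, E).tangent (slit E M)) :
    lieTensor S tangentStructure (lieTensor S tangentStructure X) = X := by
  have h1 : tangentStructure (lieTensor S tangentStructure X) = -tangentStructure X := by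
    change tangentStructure (bracket S (tangentStructure X) - tangentStructure (bracket S X)) = _
    rw [map_sub, tangentStructure_sq, tangentStructure_bracket hS (tangentStructure_sq X), sub_zero]
  have h2 : tangentStructure (lieTensor S tangentStructure X + X) = 0 := by
    rw [map_add, h1, neg_add_cancel]
  have h3 := lieTensor_vertical hS h2
  rw [map_add, add_comm] at h3
  exact add_left_cancel h3

theorem horProj_add_verProj {S : VField 𝓘(ℝ, E).tangent (slit E M)} (hS : IsSemispray S)
    (X : VField 𝓘(ℝ, E).tangent (slit E M)) :
    horProj S (horProj S X) + verProj S (verProj S X) = X := by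
  simp only [horProj, verProj, LinearMap.smul_apply, LinearMap.sub_apply, LinearMap.add_apply,
    LinearMap.id_apply]
  set L := lieTensor S tangentStructure
  have hL : L (L X) = X := lieTensor_sq hS X
  have hc : ∀ (A : Tensor11 𝓘(ℝ, E).tangent (slit E M)) (c : ℝ) Y, A (c • Y) = c • A Y := by
    intro A c Y
    have : ∀ Z : VField 𝓘(ℝ, E).tangent (slit E M),
      c • Z = (algebraMap ℝ (SmoothFn 𝓘(ℝ, E).tangent (slit E M)) c) • Z := fun Z ↦ rfl
    rw [this, this, map_smul]
  simp only [hc, map_sub, map_add, hL]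
  module

theorem nablaVField_add (S X Y : VField 𝓘(ℝ, E).tangent (slit E M)) :
    nablaVField S (X + Y) = nablaVField S X + nablaVField S Y := by
  simp only [nablaVField, map_add, bracket_add]
  abel

theorem nablaVField_smul {S : VField 𝓘(ℝ, E).tangent (slit E M)} (hS : IsSemispray S)
    (f : SmoothFn 𝓘(ℝ, E).tangent (slit E M)) (X : VField 𝓘(ℝ, E).tangent (slit E M)) :
    nablaVField S (f • X) = lieFn S f • X + f • nablaVField S X := by
  have h := horProj_add_verProj hS X
  nth_rewrite 2 [← h]
  simp only [nablaVField, map_smul, bracket_smul, map_add, smul_add]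
  abel

/-- The dynamical covariant derivative of a semispray on `k`-forms:
`(∇ α)(X₁, …, X_k) = S (α(X₁, …, X_k)) - ∑ i, α(X₁, …, ∇ X_i, …, X_k)`. -/
def nablaForm (S : VField 𝓘(ℝ, E).tangent (slit E M)) (hS : IsSemispray S) {k : ℕ}
    (α : Form 𝓘(ℝ, E).tangent (slit E M) k) : Form 𝓘(ℝ, E).tangent (slit E M) k :=
  derivForm S (nablaVField S) (nablaVField_add S) (nablaVField_smul hS) α

end Slit

end TangentCalculus

end

/-! The whole theorem comes from reading `S` and `C = liouville` as eigenfields of `L_S J`. Since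
`JS = C`, one has `(L_S J)(S) = [S, C] - J[S, S]`, and homogeneity `[C, S] = S` makes this `-S`
(`IsSpray.lieTensor_self`): a spray is horizontal with respect to its own connection. On the other
hand `C = JS` is vertical because `J² = 0`, and `L_S J` is the identity on vertical fields
(`lieTensor_vertical`).

With `hS = S` and `vS = 0`, the derivative `∇S` collapses to `h[S, S] = 0`. With `hC = 0` and `vC =
C`, the derivative `∇C` collapses to `v[S, C] = -vS = 0`. So one computation, `vS = 0`, serves both
fields.

The commutation with inner products is then formal. In the Leibniz rule for `∇ω` evaluated on `(X,
Y₁, …)`, the only term absent from `∇(i_X ω)` is `ω(∇X, Y₁, …)`, which vanishes as soon as `∇X = 0`.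
This is `derivForm_innerProd`, used once for `S` and once for `C`. -/

namespace TangentCalculus

/-! ### Leibniz derivations against inner products, and bracket identities -/

section Generic

variable {F : Type*} [NormedAddCommGroup F] [NormedSpace ℝ F] {H : Type*} [TopologicalSpace H]
  {I : ModelWithCorners ℝ F H} {N : Type*} [TopologicalSpace N] [ChartedSpace H N]
  [IsManifold I ∞ N]

/-- A derivation of forms commutes with the inner product by a vector field that it kills. -/
theorem derivForm_innerProd (S : VField I N) (D : VField I N → VField I N)
    (hadd : ∀ X Y, D (X + Y) = D X + D Y)
    (hsmul : ∀ (f : SmoothFn I N) X, D (f • X) = lieFn S f • X + f • D X)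
    {X : VField I N} (hX : D X = 0) (k : ℕ) (α : Form I N k) :
    derivForm S D hadd hsmul (innerProd X k α) =
      innerProd X k (derivForm S D hadd hsmul α) := by
  cases k with
  | zero =>
    ext1 Y
    -- In degree 0 the truncated `0 - 1` is again 0 and `innerProd` is the zero form, so the right
    -- side is zero by definition and the left side is the derivation applied to the zero form.
    change lieFn S 0 - ∑ i, (0 : SmoothFn I N) = 0
    rw [lieFn_zero, Finset.sum_const_zero, sub_zero]
  | succ n =>
    ext1 Y
    -- Currying puts `X` in slot 0, so both sides have the same leading term. What remains is to
    -- compare a sum over `n` slots with a sum over `n + 1` slots.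
    change lieFn S (α (Matrix.vecCons X Y)) -
        ∑ i, α (Matrix.vecCons X (Function.update Y i (D (Y i)))) =
      lieFn S (α (Matrix.vecCons X Y)) -
        ∑ i, α (Function.update (Matrix.vecCons X Y) i (D (Matrix.vecCons X Y i)))
    congr 1
    -- The extra summand is slot 0, where `D X = 0` is inserted, so multilinearity kills it.
    rw [Fin.sum_univ_succ, Matrix.cons_val_zero, hX, α.map_update_zero, zero_add]
    refine Finset.sum_congr rfl fun i _ ↦ ?_
    rw [Matrix.cons_val_succ]
    -- Updating slot `i` of `Y` and then prepending `X` is the same as updating slot `i + 1`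
    -- afterwards.
    exact congrArg α (Fin.cons_update (α := fun _ ↦ VField I N) X Y i (D (Y i)))

variable [CompleteSpace F]

theorem bracket_swap (X Y : VField I N) : bracket X Y = -bracket Y X := by
  ext p
  exact VectorField.mlieBracket_swap_apply

theorem bracket_self (X : VField I N) : bracket X X = 0 := by
  ext p
  exact congrFun VectorField.mlieBracket_self p

theorem bracket_zero (X : VField I N) : bracket X 0 = 0 := by
  simpa using bracket_add X 0 0

end Generic

/-! ### The spray and the Liouville field as eigenfields of `L_S J` -/

section Spray

variable {E : Type*} [NormedAddCommGroup E] [NormedSpace ℝ E] [CompleteSpace E]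
  {M : Type*} [TopologicalSpace M] [ChartedSpace E M] [IsManifold 𝓘(ℝ, E) ∞ M]
  {S X : VField 𝓘(ℝ, E).tangent (slit E M)}

theorem IsSpray.bracket_liouville (hS : IsSpray S) : bracket S liouville = -S := by
  rw [bracket_swap, hS.2]

/-- The semispray condition turns the first bracket into `[S, C]`, which homogeneity and
antisymmetry evaluate; the second bracket is `[S, S] = 0`. In the connection defined by `S` this
says that `S` is horizontal. -/
theorem IsSpray.lieTensor_self (hS : IsSpray S) : lieTensor S tangentStructure S = -S := by
  change bracket S (tangentStructure S) - tangentStructure (bracket S S) = -S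
  rw [(hS.1 : tangentStructure S = liouville), hS.bracket_liouville, bracket_self, map_zero,
    sub_zero]

/-- As `h` and `v` are `(Id ∓ L_S J) / 2`, they act as 1 and 0 on eigenfields of `L_S J` for the
eigenvalue -1, and as 0 and 1 for the eigenvalue +1. This lemma and the next three record the four
cases. -/
theorem horProj_eq_self (h : lieTensor S tangentStructure X = -X) : horProj S X = X := by
  change (1 / 2 : ℝ) • (X - lieTensor S tangentStructure X) = X
  rw [h]
  module

theorem verProj_eq_zero (h : lieTensor S tangentStructure X = -X) : verProj S X = 0 := by
  change (1 / 2 : ℝ) • (X + lieTensor S tangentStructure X) = 0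
  rw [h, add_neg_cancel, smul_zero]

theorem horProj_eq_zero (h : lieTensor S tangentStructure X = X) : horProj S X = 0 := by
  change (1 / 2 : ℝ) • (X - lieTensor S tangentStructure X) = 0
  rw [h, sub_self, smul_zero]

theorem verProj_eq_self (h : lieTensor S tangentStructure X = X) : verProj S X = X := by
  change (1 / 2 : ℝ) • (X + lieTensor S tangentStructure X) = X
  rw [h]
  module

theorem IsSpray.nablaVField_self (hS : IsSpray S) : nablaVField S S = 0 := by
  rw [nablaVField, horProj_eq_self hS.lieTensor_self, verProj_eq_zero hS.lieTensor_self,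
    bracket_self, bracket_zero, map_zero, map_zero, add_zero]

/-- The bracket of `S` with the vertical field `C` is `-S`, which is horizontal, so the outer
projector `v` annihilates it. -/
theorem IsSpray.nablaVField_liouville (hS : IsSpray S) : nablaVField S liouville = 0 := by
  have h := lieTensor_vertical hS.1 (W := liouville)
    -- Verticality of `C`: written as `JS`, it is killed by `J` because `J² = 0`.
    (by rw [← (hS.1 : tangentStructure S = liouville), tangentStructure_sq])
  rw [nablaVField, horProj_eq_zero h, verProj_eq_self h, bracket_zero, map_zero, zero_add,
    hS.bracket_liouville, map_neg, verProj_eq_zero hS.lieTensor_self, neg_zero]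

end Spray

end TangentCalculus

theorem mainTheorem7
    {E : Type*} [NormedAddCommGroup E] [NormedSpace ℝ E] [FiniteDimensional ℝ E]
    {M : Type*} [TopologicalSpace M] [T2Space M] [SecondCountableTopology M]
    [ChartedSpace E M] [IsManifold 𝓘(ℝ, E) ∞ M]
    (S : TangentCalculus.VField 𝓘(ℝ, E).tangent (TangentCalculus.slit E M))
    (hS : TangentCalculus.IsSpray S) :
    (TangentCalculus.nablaVField S S = 0 ∧
      TangentCalculus.nablaVField S TangentCalculus.liouville = 0) ∧
    (∀ (k : ℕ) (α : TangentCalculus.Form 𝓘(ℝ, E).tangent (TangentCalculus.slit E M) k),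
      TangentCalculus.nablaForm S hS.1 (TangentCalculus.innerProd S k α) =
        TangentCalculus.innerProd S k (TangentCalculus.nablaForm S hS.1 α)) ∧
    (∀ (k : ℕ) (α : TangentCalculus.Form 𝓘(ℝ, E).tangent (TangentCalculus.slit E M) k),
      TangentCalculus.nablaForm S hS.1 (TangentCalculus.innerProd TangentCalculus.liouville k α) =
        TangentCalculus.innerProd TangentCalculus.liouville k (TangentCalculus.nablaForm S hS.1 α)) := by
  -- `nablaForm` unfolds to `derivForm` with `D = nablaVField S`, so each commutation rule follows
  -- directly from the corresponding vanishing in the first component.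
  exact ⟨⟨hS.nablaVField_self, hS.nablaVField_liouville⟩,
    TangentCalculus.derivForm_innerProd S _ _ _ hS.nablaVField_self,
    TangentCalculus.derivForm_innerProd S _ _ _ hS.nablaVField_liouville⟩
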